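/- Let $S$ be a finite set with $M=|S|\ge 1$ elements, let $q:S\to\mathbb R$ be any function, and let $H_Q$ be the diagonal Hamiltonian with $H_Q|k\rangle=q(k)|k\rangle$ on the space spanned by the basis states $|k\rangle$, $k\in S$. Let $|s\rangle=M^{-1/2}\sum_{k\in S}|k\rangle$ and $H_M=|s\rangle\langle s|$. For $r\ge 0$ layers and angles $\beta,\gamma\in\mathbb R^r$, the Grover-based QAOA prepares $$|\psi^{(r)}\rangle=e^{i\beta_rH_M}e^{i\gamma_rH_Q}\cdots e^{i\beta_1H_M}e^{i\gamma_1H_Q}|s\rangle .$$ For a nonempty $S_T\subseteq S$ of ratio $\rho=|S_T|/M$, let the amplification $\eta_r$ be the probability of measuring an element of $S_T$ in $|\psi^{(r)}\rangle$ divided by the probability $\rho$ of measuring one in $|s\rangle$. Then, for every $r$: (1) If $S_T$ is degenerate, i.e. $q$ is constant on $S_T$, then for all angles $\beta,\gamma\in\mathbb R^r$, $$\eta_r\le(2r+1)^2 .$$ (2) The bound is approached as $\rho\to0$ when $q$ is the binary function of $S_T$ up to a change of scale: for every $\varepsilon>0$ there is $\delta>0$ such that, for every finite set $S$, every nonempty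 $S_T\subseteq S$ with $|S_T|/|S|<\delta$ and every real $a\ne0$, if $q(k)=a$ for $k\in S_T$ and $q(k)=0$ for $k\notin S_T$, then there are angles $\beta,\gamma\in\mathbb R^r$ with $\eta_r>(2r+1)^2-\varepsilon$. -/

import Mathlib

namespace GroverQAOA

open Matrix

noncomputable section

/-- Quantum states on the span of the computational basis `|k⟩`, `k ∈ S`, are written by their
amplitudes. This is the uniform superposition `|s⟩ = M^{-1/2} ∑_k |k⟩`, with `M = |S|`. -/
def uniformState (S : Type*) [Fintype S] : S → ℂ :=
  fun _ => ((1 / Real.sqrt (Fintype.card S) : ℝ) : ℂ)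

/-- The Grover mixer Hamiltonian `H_M = |s⟩⟨s|`. -/
def mixerHamiltonian (S : Type*) [Fintype S] : Matrix S S ℂ :=
  vecMulVec (uniformState S) (star (uniformState S))

/-- The diagonal Hamiltonian `H_Q |k⟩ = q(k) |k⟩`. -/
def phaseHamiltonian {S : Type*} [DecidableEq S] (q : S → ℝ) : Matrix S S ℂ :=
  diagonal fun k => ((q k : ℝ) : ℂ)

/-- The mixing operator `U_M(β) = exp(i β H_M)`. -/
def mixer (S : Type*) [Fintype S] [DecidableEq S] (β : ℝ) : Matrix S S ℂ :=
  NormedSpace.exp ((Complex.I * (β : ℂ)) • mixerHamiltonian S)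

/-- The phase separation operator `U_P(γ) = exp(i γ H_Q)`. -/
def phaseSeparator {S : Type*} [Fintype S] [DecidableEq S] (q : S → ℝ) (γ : ℝ) : Matrix S S ℂ :=
  NormedSpace.exp ((Complex.I * (γ : ℂ)) • phaseHamiltonian q)

/-- The state `|ψ^{(r)}⟩ = U_M(β_r) U_P(γ_r) ⋯ U_M(β_1) U_P(γ_1) |s⟩` after `r` layers; the angles
of the layers `1, …, r` are indexed by `Fin r`. -/
def qaoaState {S : Type*} [Fintype S] [DecidableEq S] (q : S → ℝ) :
    (r : ℕ) → (Fin r → ℝ) → (Fin r → ℝ) → S → ℂ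
  | 0, _, _ => uniformState S
  | r + 1, β, γ =>
      mixer S (β (Fin.last r)) *ᵥ (phaseSeparator q (γ (Fin.last r)) *ᵥ
        qaoaState q r (fun j => β j.castSucc) (fun j => γ j.castSucc))

/-- The probability that a measurement of `ψ` in the computational basis yields an element
of `T`. -/
def measureProb {S : Type*} (ψ : S → ℂ) (T : Finset S) : ℝ :=
  ∑ k ∈ T, ‖ψ k‖ ^ 2

/-- The ratio `ρ = |T| / M`. -/
def ratio {S : Type*} [Fintype S] (T : Finset S) : ℝ :=
  (T.card : ℝ) / (Fintype.card S : ℝ)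

/-- The set `T` is degenerate for `H_Q`: its elements have one common value of `q`. -/
def IsDegenerate {S : Type*} (q : S → ℝ) (T : Finset S) : Prop :=
  ∃ x₀ : ℝ, ∀ k ∈ T, q k = x₀

/-- The amplification `η_r` of the probability of measuring an element of `T`: the probability
in the final state divided by the probability in the initial state. -/
def amplification {S : Type*} [Fintype S] [DecidableEq S] (q : S → ℝ) (T : Finset S)
    (r : ℕ) (β γ : Fin r → ℝ) : ℝ :=
  measureProb (qaoaState q r β γ) T / measureProb (uniformState S) T

/-- The binary function with marked set `T` on the scale `a`: the value `a` on marked elements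
and `0` on the others. -/
def scaledBinary {S : Type*} [DecidableEq S] (T : Finset S) (a : ℝ) : S → ℝ :=
  fun k => if k ∈ T then a else 0

end

end GroverQAOA

/-!
Both Hamiltonians have elementary exponentials: `exp (iγ H_Q)` is diagonal with unimodular
entries, and `H_M` is a rank-one projection, so
`exp (iβ H_M) ψ = ψ + (e^{iβ} - 1) ⟨s|ψ⟩ |s⟩` (`mixer_mulVec_apply`).

Upper bound. Every entry of `|s⟩` equals `M^{-1/2}`, and `|⟨s|ψ⟩| ≤ 1` for a unit vector `ψ`, so one
layer raises the modulus of any single amplitude by at most `|e^{iβ} - 1| M^{-1/2} ≤ 2 M^{-1/2}`.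
The moduli start at `M^{-1/2}`, hence after `r` layers they are at most `(2r + 1) M^{-1/2}`
(`norm_qaoaState_apply_le`). Squaring and summing over `T` gives the bound on the amplification.

Sharpness. With `γ = π / a` and `β = π` a layer is one Grover iteration, and the state keeps
amplitudes `x M^{-1/2}` on `T` and `y M^{-1/2}` off `T`, where `(x, y)` obeys a recursion that
involves only the ratio `ρ` (`groverAmplitudes`). The amplification is then `x ^ 2`. For each `r`
the number `x` is a polynomial in `ρ`, with value `±(2r + 1)` at `ρ = 0`, so continuity at `0` gives
a `δ` that does not depend on `S`, `T` and `a`.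
-/

namespace GroverQAOA

open Matrix

/-! ### Exponentials of the two Hamiltonians -/

/-- All powers of `P` beyond the zeroth equal `P`, so only the constant term of the series differs
from `(exp c) • P`. -/
theorem exp_smul_of_isIdempotentElem {n : Type*} [Fintype n] [DecidableEq n]
    {P : Matrix n n ℂ} (hP : IsIdempotentElem P) (c : ℂ) :
    NormedSpace.exp (c • P) = 1 + (Complex.exp c - 1) • P := by
  have hterm : (fun k : ℕ => ((k.factorial : ℂ)⁻¹) • (c • P) ^ k) =
      fun k : ℕ => ((k.factorial : ℂ)⁻¹ • c ^ k) • P + if k = 0 then 1 - P else 0 := by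
    funext k
    rcases k with _ | k
    · simp
    · simp [smul_pow, hP.pow_succ_eq, smul_smul]
  have hexp : HasSum (fun k : ℕ => (k.factorial : ℂ)⁻¹ • c ^ k) (Complex.exp c) := by
    rw [Complex.exp_eq_exp_ℂ]
    exact NormedSpace.exp_series_hasSum_exp' c
  have hsum := (hexp.smul_const P).add (hasSum_ite_eq 0 (1 - P))
  rw [NormedSpace.exp_eq_tsum ℂ]
  simp only [hterm]
  rw [hsum.tsum_eq, sub_smul, one_smul]
  abel

/-- The exponential of a skew-adjoint matrix is unitary, stated as conservation of total probability. -/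
theorem sum_norm_sq_exp_mulVec {n : Type*} [Fintype n] [DecidableEq n]
    {A : Matrix n n ℂ} (hA : Aᴴ = -A) (ψ : n → ℂ) :
    ∑ k, ‖(NormedSpace.exp A *ᵥ ψ) k‖ ^ 2 = ∑ k, ‖ψ k‖ ^ 2 := by
  have hU : (NormedSpace.exp A)ᴴ * NormedSpace.exp A = 1 := by
    rw [← Matrix.exp_conjTranspose, hA, Matrix.exp_neg]
    exact Matrix.nonsing_inv_mul _ ((Matrix.isUnit_iff_isUnit_det _).1 (Matrix.isUnit_exp A))
  have hnorm : ∀ φ : n → ℂ, ((∑ k, ‖φ k‖ ^ 2 : ℝ) : ℂ) = star φ ⬝ᵥ φ := by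
    intro φ
    simp [dotProduct, ← Complex.conj_mul']
  have h : ((∑ k, ‖(NormedSpace.exp A *ᵥ ψ) k‖ ^ 2 : ℝ) : ℂ) = ((∑ k, ‖ψ k‖ ^ 2 : ℝ) : ℂ) := by
    rw [hnorm, hnorm, star_mulVec, ← dotProduct_mulVec, mulVec_mulVec, hU, one_mulVec]
  exact_mod_cast h

section

variable {S : Type*} [Fintype S]

theorem star_uniformState_dotProduct (ψ : S → ℂ) :
    star (uniformState S) ⬝ᵥ ψ = ((1 / Real.sqrt (Fintype.card S) : ℝ) : ℂ) * ∑ k, ψ k := by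
  simp only [dotProduct, Pi.star_apply, uniformState, Finset.mul_sum, Complex.star_def,
    Complex.conj_ofReal]

theorem sum_norm_sq_uniformState [Nonempty S] : ∑ k, ‖uniformState S k‖ ^ 2 = 1 := by
  have h : (Fintype.card S : ℝ) ≠ 0 := by exact_mod_cast Fintype.card_ne_zero
  simp [uniformState, abs_of_nonneg (Real.sqrt_nonneg _), h]

theorem isIdempotentElem_mixerHamiltonian [Nonempty S] :
    IsIdempotentElem (mixerHamiltonian S) := by
  have hs : star (uniformState S) ⬝ᵥ uniformState S = 1 := by
    have h : star (uniformState S) ⬝ᵥ uniformState S =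
        ((∑ k, ‖uniformState S k‖ ^ 2 : ℝ) : ℂ) := by
      simp [dotProduct, ← Complex.conj_mul']
    rw [h, sum_norm_sq_uniformState, Complex.ofReal_one]
  rw [IsIdempotentElem, mixerHamiltonian, vecMulVec_mul_vecMulVec, hs, one_smul]

theorem measureProb_uniformState (T : Finset S) :
    measureProb (uniformState S) T = ratio T := by
  simp [measureProb, uniformState, ratio, abs_of_nonneg (Real.sqrt_nonneg _), div_eq_mul_inv]

theorem ratio_pos {T : Finset S} (hT : T.Nonempty) : 0 < ratio T := by
  have : Nonempty S := ⟨hT.choose⟩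
  have hT' : (0 : ℝ) < T.card := by exact_mod_cast hT.card_pos
  have hS : (0 : ℝ) < Fintype.card S := by exact_mod_cast Fintype.card_pos
  exact div_pos hT' hS

variable [DecidableEq S]

/-- The mixer adds to every amplitude the same number, a multiple of the mean amplitude. -/
theorem mixer_mulVec_apply [Nonempty S] (β : ℝ) (ψ : S → ℂ) (k : S) :
    (mixer S β *ᵥ ψ) k =
      ψ k + (Complex.exp (β * Complex.I) - 1) * ((∑ j, ψ j) / Fintype.card S) := by
  have hM : ((1 / Real.sqrt (Fintype.card S) : ℝ) : ℂ) * ((1 / Real.sqrt (Fintype.card S) : ℝ) : ℂ)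
      = 1 / (Fintype.card S : ℂ) := by
    rw [← Complex.ofReal_mul, div_mul_div_comm, Real.mul_self_sqrt (Nat.cast_nonneg _)]
    simp
  have hH : (mixerHamiltonian S *ᵥ ψ) k = (∑ j, ψ j) / Fintype.card S := by
    rw [mixerHamiltonian, vecMulVec_mulVec, star_uniformState_dotProduct]
    simp only [Pi.smul_apply, op_smul_eq_mul, uniformState]
    rw [← mul_assoc, hM]
    ring
  rw [mixer, exp_smul_of_isIdempotentElem isIdempotentElem_mixerHamiltonian, add_mulVec,
    one_mulVec, smul_mulVec, Pi.add_apply, Pi.smul_apply, hH, smul_eq_mul, mul_comm Complex.I]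

theorem phaseSeparator_mulVec_apply (q : S → ℝ) (γ : ℝ) (ψ : S → ℂ) (k : S) :
    (phaseSeparator q γ *ᵥ ψ) k = Complex.exp ((γ * q k : ℝ) * Complex.I) * ψ k := by
  rw [phaseSeparator, phaseHamiltonian, ← diagonal_smul, Matrix.exp_diagonal, mulVec_diagonal,
    Pi.coe_exp, ← Complex.exp_eq_exp_ℂ]
  congr 2
  simp only [Pi.smul_apply, smul_eq_mul, Complex.ofReal_mul]
  ring

/-! ### The upper bound -/

theorem sum_norm_sq_qaoaState [Nonempty S] (q : S → ℝ) (r : ℕ) (β γ : Fin r → ℝ) :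
    ∑ k, ‖qaoaState q r β γ k‖ ^ 2 = 1 := by
  induction r with
  | zero => exact sum_norm_sq_uniformState
  | succ r ih =>
    have hM : ∀ b : ℝ, ((Complex.I * (b : ℂ)) • mixerHamiltonian S)ᴴ =
        -((Complex.I * (b : ℂ)) • mixerHamiltonian S) := by
      intro b
      rw [conjTranspose_smul, mixerHamiltonian, conjTranspose_vecMulVec, star_star]
      simp
    have hQ : ∀ g : ℝ, ((Complex.I * (g : ℂ)) • phaseHamiltonian q)ᴴ =
        -((Complex.I * (g : ℂ)) • phaseHamiltonian q) := by
      intro g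
      have hq : star (fun k => ((q k : ℝ) : ℂ)) = fun k => ((q k : ℝ) : ℂ) := by
        funext k
        simp
      rw [conjTranspose_smul, phaseHamiltonian, diagonal_conjTranspose, hq]
      simp
    rw [qaoaState, mixer, sum_norm_sq_exp_mulVec (hM _), phaseSeparator,
      sum_norm_sq_exp_mulVec (hQ _), ih]

/-- The bound holds for every single basis state: the phase separator does not change moduli, and
the mixer moves each amplitude by at most `2 / √M`. -/
theorem norm_qaoaState_apply_le [Nonempty S] (q : S → ℝ) (r : ℕ) (β γ : Fin r → ℝ) (k : S) :
    ‖qaoaState q r β γ k‖ ≤ (2 * r + 1) / Real.sqrt (Fintype.card S) := by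
  induction r with
  | zero => simp [qaoaState, uniformState, abs_of_nonneg (Real.sqrt_nonneg _)]
  | succ r ih =>
    set φ := phaseSeparator q (γ (Fin.last r)) *ᵥ
      qaoaState q r (fun j => β j.castSucc) (fun j => γ j.castSucc) with hφ
    have hφk : ∀ j, ‖φ j‖ =
        ‖qaoaState q r (fun j => β j.castSucc) (fun j => γ j.castSucc) j‖ := by
      intro j
      rw [hφ, phaseSeparator_mulVec_apply, norm_mul, Complex.norm_exp_ofReal_mul_I, one_mul]
    have hcard : (0 : ℝ) < Fintype.card S := by exact_mod_cast Fintype.card_pos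
    have hsqrt := Real.sqrt_pos.2 hcard
    -- Cauchy–Schwarz for a unit vector
    have hsum : ‖∑ j, φ j‖ ≤ Real.sqrt (Fintype.card S) := by
      refine (norm_sum_le _ _).trans (Real.le_sqrt_of_sq_le ?_)
      have h := sq_sum_le_card_mul_sum_sq (s := Finset.univ) (f := fun j => ‖φ j‖)
      simp only [hφk, sum_norm_sq_qaoaState, mul_one, Finset.card_univ] at h ⊢
      exact h
    have hphase : ‖Complex.exp (β (Fin.last r) * Complex.I) - 1‖ ≤ 2 := by
      refine (norm_sub_le _ _).trans ?_
      rw [Complex.norm_exp_ofReal_mul_I, norm_one]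
      norm_num
    have hmean : ‖(∑ j, φ j) / (Fintype.card S : ℂ)‖ ≤ 1 / Real.sqrt (Fintype.card S) := by
      rw [norm_div, Complex.norm_natCast, div_le_div_iff₀ hcard hsqrt, one_mul]
      calc ‖∑ j, φ j‖ * Real.sqrt (Fintype.card S)
          ≤ Real.sqrt (Fintype.card S) * Real.sqrt (Fintype.card S) := by gcongr
        _ = Fintype.card S := Real.mul_self_sqrt hcard.le
    rw [qaoaState, ← hφ, mixer_mulVec_apply]
    calc _ ≤ ‖φ k‖ + ‖Complex.exp (β (Fin.last r) * Complex.I) - 1‖ *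
            ‖(∑ j, φ j) / (Fintype.card S : ℂ)‖ := by
          rw [← norm_mul]
          exact norm_add_le _ _
      _ ≤ (2 * r + 1) / Real.sqrt (Fintype.card S) + 2 * (1 / Real.sqrt (Fintype.card S)) := by
          rw [hφk]
          gcongr
          exact ih _ _
      _ = (2 * (r + 1 : ℕ) + 1) / Real.sqrt (Fintype.card S) := by
          push_cast
          ring

theorem amplification_le (q : S → ℝ) {T : Finset S} (hT : T.Nonempty) (r : ℕ)
    (β γ : Fin r → ℝ) : amplification q T r β γ ≤ (2 * (r : ℝ) + 1) ^ 2 := by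
  have : Nonempty S := ⟨hT.choose⟩
  rw [amplification, measureProb_uniformState, div_le_iff₀ (ratio_pos hT)]
  calc measureProb (qaoaState q r β γ) T
      ≤ ∑ _k ∈ T, ((2 * (r : ℝ) + 1) / Real.sqrt (Fintype.card S)) ^ 2 := by
        refine Finset.sum_le_sum fun k _ => ?_
        gcongr
        exact norm_qaoaState_apply_le q r β γ k
    _ = (2 * (r : ℝ) + 1) ^ 2 * ratio T := by
        rw [Finset.sum_const, nsmul_eq_mul, div_pow, Real.sq_sqrt (Nat.cast_nonneg _), ratio]
        ring

end

/-! ### Grover iterations attain the bound in the limit -/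

/-- The amplitudes on and off the marked set after `n` Grover iterations, in units of `M^{-1/2}`,
when the marked set has ratio `ρ`: an iteration flips the sign of the marked amplitude and then
subtracts twice the mean `-ρ x + (1 - ρ) y` from both. -/
def groverAmplitudes (ρ : ℝ) : ℕ → ℝ × ℝ
  | 0 => (1, 1)
  | n + 1 =>
    let x := (groverAmplitudes ρ n).1
    let y := (groverAmplitudes ρ n).2
    (-x - 2 * (-(ρ * x) + (1 - ρ) * y), y - 2 * (-(ρ * x) + (1 - ρ) * y))

theorem continuous_groverAmplitudes (n : ℕ) : Continuous fun ρ => groverAmplitudes ρ n := by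
  induction n with
  | zero => exact continuous_const
  | succ n ih =>
    simp only [groverAmplitudes]
    fun_prop

/-- In the limit `ρ = 0` the mean is the unmarked amplitude, so each iteration adds `2` to the modulus
of the marked one. -/
theorem groverAmplitudes_zero (n : ℕ) :
    groverAmplitudes 0 n = ((-1 : ℝ) ^ n * (2 * n + 1), (-1 : ℝ) ^ n) := by
  induction n with
  | zero => simp [groverAmplitudes]
  | succ n ih =>
    simp only [groverAmplitudes, ih, Prod.mk.injEq]
    constructor
    · push_cast
      ring
    · ring

/-- At `γ = π / a` and `β = π` both operators are reflections (up to sign, those of Grover's search). -/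
theorem qaoaState_scaledBinary {S : Type*} [Fintype S] [DecidableEq S] [Nonempty S]
    (T : Finset S) {a : ℝ} (ha : a ≠ 0) (r : ℕ) (k : S) :
    qaoaState (scaledBinary T a) r (fun _ => Real.pi) (fun _ => Real.pi / a) k =
      uniformState S k * ((if k ∈ T then (groverAmplitudes (ratio T) r).1
        else (groverAmplitudes (ratio T) r).2 : ℝ) : ℂ) := by
  induction r generalizing k with
  | zero => simp [qaoaState, groverAmplitudes]
  | succ r ih =>
    set x := (groverAmplitudes (ratio T) r).1 with hx
    set y := (groverAmplitudes (ratio T) r).2 with hy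
    have hcard : (Fintype.card S : ℝ) ≠ 0 := by exact_mod_cast Fintype.card_ne_zero
    have hφ : ∀ j, (phaseSeparator (scaledBinary T a) (Real.pi / a) *ᵥ
        qaoaState (scaledBinary T a) r (fun _ => Real.pi) (fun _ => Real.pi / a)) j =
        uniformState S j * ((if j ∈ T then -x else y : ℝ) : ℂ) := by
      intro j
      rw [phaseSeparator_mulVec_apply, ih, scaledBinary]
      split_ifs
      -- the phase on a marked element is `exp (i (π / a) a) = -1`
      · rw [div_mul_cancel₀ _ ha, Complex.exp_pi_mul_I]
        push_cast
        ring
      · simp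
    have hmean : (∑ j, if j ∈ T then -x else y) / (Fintype.card S : ℝ) =
        -(ratio T * x) + (1 - ratio T) * y := by
      have hite : ∀ j, (if j ∈ T then -x else y) = y + if j ∈ T then -x - y else 0 := by
        intro j
        split_ifs <;> ring
      simp only [hite, Finset.sum_add_distrib, Finset.sum_const, Finset.card_univ, nsmul_eq_mul,
        Finset.sum_ite_mem, Finset.univ_inter, ratio]
      field_simp
      ring
    have hmeanC : (∑ j, uniformState S j * ((if j ∈ T then -x else y : ℝ) : ℂ)) /
        (Fintype.card S : ℂ) =
        uniformState S k * ((-(ratio T * x) + (1 - ratio T) * y : ℝ) : ℂ) := by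
      simp only [uniformState]
      rw [← hmean, ← Finset.mul_sum, mul_div_assoc, ← Complex.ofReal_sum,
        Complex.ofReal_div _ (Fintype.card S : ℝ), Complex.ofReal_natCast]
    rw [qaoaState, mixer_mulVec_apply]
    simp only [hφ]
    rw [hmeanC, Complex.exp_pi_mul_I]
    simp only [groverAmplitudes, ← hx, ← hy]
    split_ifs <;> push_cast <;> ring

theorem amplification_scaledBinary {S : Type*} [Fintype S] [DecidableEq S] {T : Finset S}
    (hT : T.Nonempty) {a : ℝ} (ha : a ≠ 0) (r : ℕ) :
    amplification (scaledBinary T a) T r (fun _ => Real.pi) (fun _ => Real.pi / a) =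
      (groverAmplitudes (ratio T) r).1 ^ 2 := by
  have : Nonempty S := ⟨hT.choose⟩
  have hprob : measureProb (qaoaState (scaledBinary T a) r (fun _ => Real.pi)
      (fun _ => Real.pi / a)) T =
      measureProb (uniformState S) T * (groverAmplitudes (ratio T) r).1 ^ 2 := by
    simp only [measureProb]
    rw [Finset.sum_mul]
    refine Finset.sum_congr rfl fun k hk => ?_
    rw [qaoaState_scaledBinary T ha, if_pos hk, norm_mul, mul_pow, Complex.norm_real,
      Real.norm_eq_abs, sq_abs]
  have hpos : measureProb (uniformState S) T ≠ 0 := by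
    rw [measureProb_uniformState]
    exact (ratio_pos hT).ne'
  rw [amplification, hprob, mul_div_cancel_left₀ _ hpos]

end GroverQAOA

theorem lemma2 (r : ℕ) :
    (∀ (S : Type*) [Fintype S] [DecidableEq S] (q : S → ℝ) (T : Finset S),
      T.Nonempty → GroverQAOA.IsDegenerate q T →
      ∀ β γ : Fin r → ℝ,
        GroverQAOA.amplification q T r β γ ≤ (2 * (r : ℝ) + 1) ^ 2) ∧
    (∀ ε : ℝ, 0 < ε → ∃ δ : ℝ, 0 < δ ∧
      ∀ (S : Type*) [Fintype S] [DecidableEq S] (T : Finset S),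
        T.Nonempty → GroverQAOA.ratio T < δ →
        ∀ a : ℝ, a ≠ 0 → ∃ β γ : Fin r → ℝ,
          (2 * (r : ℝ) + 1) ^ 2 - ε <
            GroverQAOA.amplification (GroverQAOA.scaledBinary T a) T r β γ) := by
  refine ⟨fun S _ _ q T hT _ β γ => GroverQAOA.amplification_le q hT r β γ, fun ε hε => ?_⟩
  have hcont : Continuous fun ρ => (GroverQAOA.groverAmplitudes ρ r).1 ^ 2 :=
    (GroverQAOA.continuous_groverAmplitudes r).fst.pow 2
  have hzero : (GroverQAOA.groverAmplitudes 0 r).1 ^ 2 = (2 * (r : ℝ) + 1) ^ 2 := by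
    rw [GroverQAOA.groverAmplitudes_zero, mul_pow, pow_right_comm, neg_one_sq, one_pow, one_mul]
  obtain ⟨δ, hδ, h⟩ := Metric.continuous_iff.1 hcont 0 ε hε
  refine ⟨δ, hδ, fun S _ _ T hT hρ a ha => ⟨fun _ => Real.pi, fun _ => Real.pi / a, ?_⟩⟩
  have hdist := h (GroverQAOA.ratio T) (by
    rwa [Real.dist_eq, sub_zero, abs_of_pos (GroverQAOA.ratio_pos hT)])
  rw [hzero, Real.dist_eq] at hdist
  rw [GroverQAOA.amplification_scaledBinary hT ha]
  linarith [(abs_lt.1 hdist).1]
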